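/- Let $\mathbb K\in\{\mathbb R,\mathbb C\}$ and let $X$ be a reflexive Banach space over $\mathbb K$ (i.e. the canonical embedding $X\to X^{**}$ is onto). Let $B(X)$ be the space of bounded linear operators on $X$ with the operator norm. For a Banach space $E$, let $\ell^2(E)$ be the Banach space of sequences $(e_n)_{n\in\mathbb N}$ in $E$ with $\sum_n\|e_n\|^2<\infty$. For an ultrafilter $\mathcal U$ on a set $I$, let $$E_{\mathcal U}=\ell^\infty(E,I)\big/\{(e^\alpha)_{\alpha\in I}\in \ell^\infty(E,I):\lim_{\mathcal U}\|e^\alpha\|=0\}$$ be the ultrapower of $E$, where $\ell^\infty(E,I)$ is the space of bounded families $(e^\alpha)_{\alpha\in I}$ in $E$; write $(e^\alpha)_{\mathcal U}$ for the class of $(e^\alpha)_{\alpha\in I}$. The ultrafilter $\mathcal U$ is called countably incomplete if there are sets $I_1\supseteq I_2\supseteq\cdots$ in $\mathcal U$ with $\bigcap_n I_n=\emptyset$. For $x_{\mathcal U}=(x^\alpha)_{\mathcal U}\in\ell^2(X)_{\mathcal U}$ and $f_{\mathcal U}=(f^\alpha)_{\mathcal U}\in\ell^2(X^*)_{\mathcal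 U}$, with $x^\alpha=(x^\alpha_n)_n$ and $f^\alpha=(f^\alpha_n)_n$, let $x_{\mathcal U}\otimes f_{\mathcal U}\in B(X)^*$ be the bounded linear functional $$(x_{\mathcal U}\otimes f_{\mathcal U})(T)=\lim_{\mathcal U}\sum_{n} f^\alpha_n(Tx^\alpha_n)\qquad(T\in B(X)),$$ which does not depend on the chosen representatives. Then there exist a set $I$ and a countably incomplete ultrafilter $\mathcal U$ on $I$ such that for every $\lambda\in B(X)^*$ there are $x_{\mathcal U}\in\ell^2(X)_{\mathcal U}$ and $f_{\mathcal U}\in\ell^2(X^*)_{\mathcal U}$ with $\lambda=x_{\mathcal U}\otimes f_{\mathcal U}$. -/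

import Mathlib

open Filter Topology
open scoped ENNReal

universe u

noncomputable section

/-- A normed space is reflexive if the canonical embedding into its bidual is surjective. -/
def IsReflexiveSpace (𝕜 X : Type*) [RCLike 𝕜] [NormedAddCommGroup X] [NormedSpace 𝕜 X] : Prop :=
  Function.Surjective (NormedSpace.inclusionInDoubleDual 𝕜 X)

/-- An ultrafilter is countably incomplete if it has a decreasing sequence of members
with empty intersection. -/
def IsCountablyIncomplete {I : Type*} (U : Ultrafilter I) : Prop :=
  ∃ s : ℕ → Set I, (∀ n, s n ∈ U) ∧ (∀ n, s (n + 1) ⊆ s n) ∧ ⋂ n, s n = ∅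

/-- `ℓ²(E)`: the space of square-summable sequences in `E`. -/
abbrev EllTwo (E : Type*) [NormedAddCommGroup E] : Type _ := lp (fun _ : ℕ => E) 2

/-- `ℓ^∞(E, I)`: the space of bounded `I`-indexed families in `E`. -/
abbrev EllInfty (I E : Type*) [NormedAddCommGroup E] : Type _ := lp (fun _ : I => E) ∞

section Ultrapower

variable (𝕜 : Type*) [RCLike 𝕜] {I : Type*} (U : Ultrafilter I)
variable (E : Type*) [NormedAddCommGroup E] [NormedSpace 𝕜 E]

/-- The subspace of the bounded families whose norms tend to `0` along the ultrafilter. -/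
def ultraNull : Submodule 𝕜 (EllInfty I E) where
  carrier := {x | Tendsto (fun α => ‖x α‖) U (𝓝 0)}
  zero_mem' := by simp
  add_mem' := by
    intro x y hx hy
    refine squeeze_zero (fun α => norm_nonneg _) (fun α => ?_) (by simpa using Tendsto.add hx hy)
    simpa using norm_add_le (x α) (y α)
  smul_mem' := by
    intro c x hx
    have h := Tendsto.const_mul ‖c‖ hx
    simpa [norm_smul] using h

/-- The ultrapower `E_U`. -/
abbrev Ultrapower : Type _ := EllInfty I E ⧸ ultraNull 𝕜 U E

variable {E}

/-- The class `(x_α)_U` of a bounded family. -/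
def Ultrapower.mk (x : EllInfty I E) : Ultrapower 𝕜 U E := (ultraNull 𝕜 U E).mkQ x

end Ultrapower

section Tensor

variable {𝕜 : Type*} [RCLike 𝕜] {X : Type*} [NormedAddCommGroup X] [NormedSpace 𝕜 X]

/-- The sum `∑ₙ fₙ(T xₙ)`, for `x ∈ ℓ²(X)` and `f ∈ ℓ²(X*)`. -/
def ellTwoSum (x : EllTwo X) (f : EllTwo (StrongDual 𝕜 X)) (T : X →L[𝕜] X) : 𝕜 :=
  ∑' n, f n (T (x n))

/-- The pairing of `ℓ²(X*)` with `ℓ²(X)`. -/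
def ellTwoPairing : EllTwo (StrongDual 𝕜 X) →L[𝕜] EllTwo X →L[𝕜] 𝕜 :=
  lp.dualPairing 2 2 (fun _ : ℕ => ContinuousLinearMap.id 𝕜 (X →L[𝕜] 𝕜)) (K := 1)
    (fun _ => ContinuousLinearMap.norm_id_le)

/-- The coordinatewise action of an operator on `ℓ²(X)`. -/
def ellTwoMap (T : X →L[𝕜] X) : EllTwo X →L[𝕜] EllTwo X :=
  lp.mapCLM 2 (fun _ : ℕ => T) (norm_nonneg T) (fun _ => le_rfl)

theorem ellTwoSum_eq (x : EllTwo X) (f : EllTwo (StrongDual 𝕜 X)) (T : X →L[𝕜] X) :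
    ellTwoSum x f T = ellTwoPairing f (ellTwoMap T x) := rfl

theorem norm_ellTwoSum_le (x : EllTwo X) (f : EllTwo (StrongDual 𝕜 X)) (T : X →L[𝕜] X) :
    ‖ellTwoSum x f T‖ ≤ ‖x‖ * ‖f‖ * ‖T‖ := by
  have h1 : ‖(ellTwoPairing : EllTwo (StrongDual 𝕜 X) →L[𝕜] EllTwo X →L[𝕜] 𝕜)‖ ≤ 1 :=
    lp.norm_dualPairing _ _
  have h2 : ‖ellTwoMap T‖ ≤ ‖T‖ := lp.norm_mapCLM_le _ _ _ _
  have h3 : ‖ellTwoMap T x‖ ≤ ‖T‖ * ‖x‖ := (ellTwoMap T).le_of_opNorm_le h2 x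
  have h4 : ‖ellTwoPairing f‖ ≤ 1 * ‖f‖ := ContinuousLinearMap.le_of_opNorm_le _ h1 f
  have h5 : ‖ellTwoPairing f (ellTwoMap T x)‖ ≤ ‖ellTwoPairing f‖ * ‖ellTwoMap T x‖ :=
    ContinuousLinearMap.le_opNorm _ _
  rw [ellTwoSum_eq]
  refine h5.trans ((mul_le_mul h4 h3 (norm_nonneg _) (by positivity)).trans (le_of_eq ?_))
  ring

theorem summable_ellTwoSum (x : EllTwo X) (f : EllTwo (StrongDual 𝕜 X)) (T : X →L[𝕜] X) :
    Summable (fun n => f n (T (x n))) :=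
  ((lp.memℓp f).holder 1 (lp.memℓp (ellTwoMap T x))
    (fun _ : ℕ => ContinuousLinearMap.id 𝕜 (X →L[𝕜] 𝕜)) (K := 1)
    (fun _ => ContinuousLinearMap.norm_id_le)).summable_of_one

theorem ellTwoSum_add (x : EllTwo X) (f : EllTwo (StrongDual 𝕜 X)) (S T : X →L[𝕜] X) :
    ellTwoSum x f (S + T) = ellTwoSum x f S + ellTwoSum x f T := by
  simp only [ellTwoSum]
  rw [← (summable_ellTwoSum x f S).tsum_add (summable_ellTwoSum x f T)]
  simp

theorem ellTwoSum_smul (x : EllTwo X) (f : EllTwo (StrongDual 𝕜 X)) (c : 𝕜) (T : X →L[𝕜] X) :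
    ellTwoSum x f (c • T) = c * ellTwoSum x f T := by
  simp [ellTwoSum, tsum_mul_left]

theorem ellTwoSum_sub_sub (x y : EllTwo X) (f g : EllTwo (StrongDual 𝕜 X)) (T : X →L[𝕜] X) :
    ellTwoSum x f T - ellTwoSum y g T = ellTwoSum (x - y) f T + ellTwoSum y (f - g) T := by
  simp [ellTwoSum_eq]

variable {I : Type*} (U : Ultrafilter I)

theorem norm_ellTwoSum_family_le (x : EllInfty I (EllTwo X))
    (f : EllInfty I (EllTwo (StrongDual 𝕜 X))) (T : X →L[𝕜] X) (α : I) :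
    ‖ellTwoSum (x α) (f α) T‖ ≤ ‖x‖ * ‖f‖ * ‖T‖ := by
  refine (norm_ellTwoSum_le _ _ _).trans ?_
  gcongr
  · exact lp.norm_apply_le_norm (by simp) x α
  · exact lp.norm_apply_le_norm (by simp) f α

/-- The limit along the ultrafilter which defines `x_U ⊗ f_U` exists. -/
theorem tendsto_limUnder_ellTwoSum (x : EllInfty I (EllTwo X))
    (f : EllInfty I (EllTwo (StrongDual 𝕜 X))) (T : X →L[𝕜] X) :
    Tendsto (fun α => ellTwoSum (x α) (f α) T) U
      (𝓝 (limUnder (U : Filter I) fun α => ellTwoSum (x α) (f α) T)) := by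
  apply tendsto_nhds_limUnder
  have h := (isCompact_closedBall (0 : 𝕜) (‖x‖ * ‖f‖ * ‖T‖)).ultrafilter_le_nhds
    (U.map fun α => ellTwoSum (x α) (f α) T) (le_principal_iff.2
      (Ultrafilter.mem_map.2 (Filter.univ_mem' fun α =>
        mem_closedBall_zero_iff.2 (norm_ellTwoSum_family_le x f T α))))
  obtain ⟨a, -, ha⟩ := h
  exact ⟨a, ha⟩

/-- The functional `T ↦ lim_U ∑ₙ f_n^α(T x_n^α)` given by two bounded families. -/
def ultraTensorRep (x : EllInfty I (EllTwo X)) (f : EllInfty I (EllTwo (StrongDual 𝕜 X))) :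
    StrongDual 𝕜 (X →L[𝕜] X) :=
  LinearMap.mkContinuous
    { toFun := fun T => limUnder (U : Filter I) fun α => ellTwoSum (x α) (f α) T
      map_add' := fun S T => Tendsto.limUnder_eq (by
        simpa only [ellTwoSum_add] using
          (tendsto_limUnder_ellTwoSum U x f S).add (tendsto_limUnder_ellTwoSum U x f T))
      map_smul' := fun c T => Tendsto.limUnder_eq (by
        simpa only [ellTwoSum_smul, RingHom.id_apply, smul_eq_mul] using (tendsto_limUnder_ellTwoSum U x f T).const_mul c) }
    (‖x‖ * ‖f‖)
    (fun T => le_of_tendsto (tendsto_limUnder_ellTwoSum U x f T).norm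
      (Eventually.of_forall fun α => norm_ellTwoSum_family_le x f T α))

theorem tendsto_ultraTensorRep (x : EllInfty I (EllTwo X))
    (f : EllInfty I (EllTwo (StrongDual 𝕜 X))) (T : X →L[𝕜] X) :
    Tendsto (fun α => ∑' n, f α n (T (x α n))) U (𝓝 (ultraTensorRep U x f T)) :=
  tendsto_limUnder_ellTwoSum U x f T

theorem ultraTensorRep_congr (x y : EllInfty I (EllTwo X))
    (f g : EllInfty I (EllTwo (StrongDual 𝕜 X)))
    (hxy : x - y ∈ ultraNull 𝕜 U (EllTwo X))
    (hfg : f - g ∈ ultraNull 𝕜 U (EllTwo (StrongDual 𝕜 X))) :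
    ultraTensorRep U x f = ultraTensorRep U y g := by
  ext T
  have hx : Tendsto (fun α => ‖x α - y α‖) U (𝓝 0) := hxy
  have hf : Tendsto (fun α => ‖f α - g α‖) U (𝓝 0) := hfg
  have key : Tendsto (fun α => ellTwoSum (x α) (f α) T - ellTwoSum (y α) (g α) T) U (𝓝 0) := by
    refine squeeze_zero_norm (a := fun α => ‖x α - y α‖ * (‖f‖ * ‖T‖)
      + ‖f α - g α‖ * (‖y‖ * ‖T‖)) (fun α => ?_) ?_
    · rw [ellTwoSum_sub_sub]
      refine (norm_add_le _ _).trans (add_le_add ?_ ?_)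
      · refine (norm_ellTwoSum_le _ _ _).trans ?_
        rw [mul_assoc]
        gcongr
        exact lp.norm_apply_le_norm (by simp) f α
      · refine (norm_ellTwoSum_le _ _ _).trans ?_
        rw [mul_comm ‖y α‖, mul_assoc]
        gcongr
        exact lp.norm_apply_le_norm (by simp) y α
    · simpa using (hx.mul_const (‖f‖ * ‖T‖)).add (hf.mul_const (‖y‖ * ‖T‖))
  have h := (tendsto_limUnder_ellTwoSum U x f T).sub (tendsto_limUnder_ellTwoSum U y g T)
  exact sub_eq_zero.1 (tendsto_nhds_unique h key)

/-- The functional `x_U ⊗ f_U` on `B(X)`, for `x_U ∈ ℓ²(X)_U` and `f_U ∈ ℓ²(X*)_U`. -/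
def ultraTensor (xU : Ultrapower 𝕜 U (EllTwo X)) (fU : Ultrapower 𝕜 U (EllTwo (StrongDual 𝕜 X))) :
    StrongDual 𝕜 (X →L[𝕜] X) :=
  Quotient.liftOn₂' xU fU (ultraTensorRep U) fun x f y g hxy hfg =>
    ultraTensorRep_congr U x y f g
      ((Submodule.quotientRel_def _).1 hxy) ((Submodule.quotientRel_def _).1 hfg)

/-- `(x_U ⊗ f_U)(T) = lim_U ∑ₙ f_n^α(T x_n^α)`, for all representatives. -/
theorem tendsto_ultraTensor_mk (x : EllInfty I (EllTwo X))
    (f : EllInfty I (EllTwo (StrongDual 𝕜 X))) (T : X →L[𝕜] X) :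
    Tendsto (fun α => ∑' n, f α n (T (x α n))) U
      (𝓝 (ultraTensor U (Ultrapower.mk 𝕜 U x) (Ultrapower.mk 𝕜 U f) T)) :=
  tendsto_ultraTensorRep U x f T

end Tensor

end

/-!
Every functional `lam` on `B(X)` is approximated on each finite set of operators by functionals
`T ↦ ∑ₙ fₙ(T xₙ)` with `‖x‖ ≤ 1` and `‖f‖ ≤ ‖lam‖` (`exists_ellTwoSum_approx`). Interleaving
sequences shows that these functionals form a convex set. A Hahn–Banach separation of its image
in the finite-dimensional space `𝕜^F` would be given by a single operator `S ∈ span F`; but the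
elementary tensors alone already satisfy `sup |f(S x)| = ‖lam‖ ‖S‖ ≥ |lam S|`, so separation is
impossible.

The index set consists of the pairs `(F, n)` of a finite set of operators and a natural number,
directed by the product order. For any ultrafilter finer than `atTop`, choosing for `(F, n)` an
approximation on `F` up to `1 / (n + 1)` gives bounded families that represent `lam`, and the sets
`{(F, k) | n ≤ k}` witness countable incompleteness. One ultrafilter serves all `lam`.
-/

section Interleave

variable {E : Type*} [NormedAddCommGroup E]

theorem hasSum_norm_sq_ellTwo (x : EllTwo E) : HasSum (fun n => ‖x n‖ ^ 2) (‖x‖ ^ 2) := by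
  simpa using lp.hasSum_norm (p := 2) (by norm_num) x

theorem hasSum_norm_sq_interleave (x y : EllTwo E) :
    HasSum (fun n => ‖if Even n then x (n / 2) else y (n / 2)‖ ^ 2) (‖x‖ ^ 2 + ‖y‖ ^ 2) := by
  refine HasSum.even_add_odd ?_ ?_
  · simpa using hasSum_norm_sq_ellTwo x
  · have h (k : ℕ) : (2 * k + 1) / 2 = k := by omega
    simpa [h] using hasSum_norm_sq_ellTwo y

/-- The sequence `x 0, y 0, x 1, y 1, …`, which realises `ℓ²(E) ⊕ ℓ²(E)` inside `ℓ²(E)`. -/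
def ellTwoInterleave (x y : EllTwo E) : EllTwo E :=
  ⟨fun n => if Even n then x (n / 2) else y (n / 2),
    memℓp_gen (by simpa using (hasSum_norm_sq_interleave x y).summable)⟩

@[simp]
theorem ellTwoInterleave_even (x y : EllTwo E) (k : ℕ) : ellTwoInterleave x y (2 * k) = x k := by
  simp [ellTwoInterleave]

@[simp]
theorem ellTwoInterleave_odd (x y : EllTwo E) (k : ℕ) :
    ellTwoInterleave x y (2 * k + 1) = y k := by
  have h : (2 * k + 1) / 2 = k := by omega
  simp [ellTwoInterleave, h]

theorem norm_sq_ellTwoInterleave (x y : EllTwo E) :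
    ‖ellTwoInterleave x y‖ ^ 2 = ‖x‖ ^ 2 + ‖y‖ ^ 2 :=
  (hasSum_norm_sq_ellTwo _).unique (hasSum_norm_sq_interleave x y)

theorem norm_interleave_sqrt_smul_le (𝕜 : Type*) [RCLike 𝕜] [NormedSpace 𝕜 E] {x y : EllTwo E}
    {M a b : ℝ} (hx : ‖x‖ ≤ M) (hy : ‖y‖ ≤ M) (ha : 0 ≤ a) (hb : 0 ≤ b) (hab : a + b = 1) :
    ‖ellTwoInterleave ((√a : 𝕜) • x) ((√b : 𝕜) • y)‖ ≤ M := by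
  have hM : 0 ≤ M := (norm_nonneg x).trans hx
  refine le_of_sq_le_sq ?_ hM
  rw [norm_sq_ellTwoInterleave, norm_smul, norm_smul, mul_pow, mul_pow]
  simp only [RCLike.norm_ofReal, sq_abs, Real.sq_sqrt ha, Real.sq_sqrt hb]
  calc a * ‖x‖ ^ 2 + b * ‖y‖ ^ 2 ≤ a * M ^ 2 + b * M ^ 2 := by gcongr
    _ = M ^ 2 := by rw [← add_mul, hab, one_mul]

end Interleave

section Approximation

variable {𝕜 : Type*} [RCLike 𝕜] {X : Type*} [NormedAddCommGroup X] [NormedSpace 𝕜 X]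

theorem ellTwoSum_interleave (x y : EllTwo X) (f g : EllTwo (StrongDual 𝕜 X)) (T : X →L[𝕜] X) :
    ellTwoSum (ellTwoInterleave x y) (ellTwoInterleave f g) T
      = ellTwoSum x f T + ellTwoSum y g T := by
  refine HasSum.tsum_eq (HasSum.even_add_odd ?_ ?_)
  · simpa [ellTwoSum] using (summable_ellTwoSum x f T).hasSum
  · simpa [ellTwoSum] using (summable_ellTwoSum y g T).hasSum

theorem ellTwoSum_smul_smul (c d : 𝕜) (x : EllTwo X) (f : EllTwo (StrongDual 𝕜 X))
    (T : X →L[𝕜] X) : ellTwoSum (c • x) (d • f) T = c * d * ellTwoSum x f T := by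
  simp [ellTwoSum_eq]
  ring

theorem ellTwoSum_single (v : X) (g : StrongDual 𝕜 X) (T : X →L[𝕜] X) :
    ellTwoSum (lp.single 2 0 v) (lp.single 2 0 g) T = g (T v) := by
  rw [ellTwoSum, tsum_eq_single 0]
  · simp
  · intro n hn
    simp [hn]

/-- The values on `F` of the functionals `T ↦ ∑ₙ fₙ(T xₙ)` with `‖x‖ ≤ 1` and `‖f‖ ≤ M`. -/
def ellTwoSumValues (F : Finset (X →L[𝕜] X)) (M : ℝ) : Set (F → 𝕜) :=
  {v | ∃ (x : EllTwo X) (f : EllTwo (StrongDual 𝕜 X)), ‖x‖ ≤ 1 ∧ ‖f‖ ≤ M ∧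
    v = fun T : F => ellTwoSum x f T}

theorem convex_ellTwoSumValues (F : Finset (X →L[𝕜] X)) (M : ℝ) :
    Convex ℝ (ellTwoSumValues F M) := by
  rintro _ ⟨x, f, hx, hf, rfl⟩ _ ⟨y, g, hy, hg, rfl⟩ a b ha hb hab
  refine ⟨_, _, norm_interleave_sqrt_smul_le 𝕜 hx hy ha hb hab,
    norm_interleave_sqrt_smul_le 𝕜 hf hg ha hb hab, ?_⟩
  funext T
  simp only [ellTwoSum_interleave, ellTwoSum_smul_smul, ← RCLike.ofReal_mul,
    Real.mul_self_sqrt ha, Real.mul_self_sqrt hb, Pi.add_apply, Pi.smul_apply,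
    RCLike.real_smul_eq_coe_mul]

/-- A linear functional on `𝕜^F`, applied to the values on `F` of a functional on `V`, evaluates
that functional at one vector of `V`. -/
theorem exists_forall_restrict_eq_apply {V : Type*} [AddCommGroup V] [Module 𝕜 V] (F : Finset V)
    (φ : (F → 𝕜) →ₗ[𝕜] 𝕜) : ∃ S : V, ∀ μ : V →ₗ[𝕜] 𝕜, φ (fun T : F => μ T) = μ S := by
  classical
  refine ⟨∑ T : F, φ (fun j => if T = j then 1 else 0) • (T : V), fun μ => ?_⟩
  rw [LinearMap.pi_apply_eq_sum_univ φ, map_sum]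
  refine Finset.sum_congr rfl fun T _ => ?_
  rw [map_smul, smul_eq_mul, smul_eq_mul, mul_comm]

/-- On elementary tensors the functionals of norm at most `M` already attain `M * ‖S‖` up to any
error. -/
theorem exists_lt_re_ellTwoSum (S : X →L[𝕜] X) {M s : ℝ} (hM : 0 ≤ M) (hs : 0 ≤ s)
    (h : s < M * ‖S‖) :
    ∃ (x : EllTwo X) (f : EllTwo (StrongDual 𝕜 X)), ‖x‖ ≤ 1 ∧ ‖f‖ ≤ M ∧
      s < RCLike.re (ellTwoSum x f S) := by
  have hM' : 0 < M := by
    refine hM.lt_of_ne' fun h0 => ?_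
    rw [h0, zero_mul] at h
    exact h.not_ge hs
  obtain ⟨v, hv, hSv⟩ := S.exists_lt_apply_of_lt_opNorm ((div_lt_iff₀' hM').2 h)
  obtain ⟨g, hg, hgv⟩ := exists_dual_vector'' 𝕜 (S v)
  refine ⟨lp.single 2 0 v, lp.single 2 0 ((M : 𝕜) • g), ?_, ?_, ?_⟩
  · rw [lp.norm_single (by norm_num)]
    exact hv.le
  · rw [lp.norm_single (by norm_num), norm_smul, RCLike.norm_ofReal, abs_of_pos hM']
    exact mul_le_of_le_one_right hM hg
  · rw [ellTwoSum_single, smul_apply, hgv, smul_eq_mul, ← RCLike.ofReal_mul, RCLike.ofReal_re]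
    exact (div_lt_iff₀' hM').1 hSv

theorem mem_closure_ellTwoSumValues (F : Finset (X →L[𝕜] X)) (lam : StrongDual 𝕜 (X →L[𝕜] X)) :
    (fun T : F => lam T) ∈ closure (ellTwoSumValues F ‖lam‖) := by
  by_contra hmem
  obtain ⟨φ, s, hφ, hs⟩ := RCLike.geometric_hahn_banach_closed_point (𝕜 := 𝕜)
    (convex_ellTwoSumValues F ‖lam‖).closure isClosed_closure hmem
  obtain ⟨S, hS⟩ := exists_forall_restrict_eq_apply F φ.toLinearMap
  have hval (x : EllTwo X) (f : EllTwo (StrongDual 𝕜 X)) :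
      φ (fun T : F => ellTwoSum x f T) = ellTwoSum x f S :=
    hS { toFun := ellTwoSum x f
         map_add' := ellTwoSum_add x f
         map_smul' := ellTwoSum_smul x f }
  have hlam : φ (fun T : F => lam T) = lam S :=
    hS lam.toLinearMap
  have hlt {x : EllTwo X} {f : EllTwo (StrongDual 𝕜 X)} (hx : ‖x‖ ≤ 1) (hf : ‖f‖ ≤ ‖lam‖) :
      RCLike.re (ellTwoSum x f S) < s := by
    rw [← hval]
    exact hφ _ (subset_closure ⟨x, f, hx, hf, rfl⟩)
  have hs0 : 0 ≤ s := by
    have h := hlt (x := 0) (f := 0) (by simp) (by rw [norm_zero]; exact norm_nonneg lam)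
    simp only [ellTwoSum_eq, map_zero] at h
    exact h.le
  rw [hlam] at hs
  obtain ⟨x, f, hx, hf, h⟩ := exists_lt_re_ellTwoSum S (norm_nonneg lam) hs0
    (hs.trans_le ((RCLike.re_le_norm _).trans (lam.le_opNorm S)))
  exact lt_asymm h (hlt hx hf)

/-- The functionals `T ↦ ∑ₙ fₙ(T xₙ)` with `‖x‖ ≤ 1` and `‖f‖ ≤ ‖lam‖` approximate `lam`
weak-star. -/
theorem exists_ellTwoSum_approx (lam : StrongDual 𝕜 (X →L[𝕜] X)) (F : Finset (X →L[𝕜] X))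
    {ε : ℝ} (hε : 0 < ε) :
    ∃ (x : EllTwo X) (f : EllTwo (StrongDual 𝕜 X)), ‖x‖ ≤ 1 ∧ ‖f‖ ≤ ‖lam‖ ∧
      ∀ T ∈ F, ‖ellTwoSum x f T - lam T‖ < ε := by
  obtain ⟨_, ⟨x, f, hx, hf, rfl⟩, hd⟩ :=
    Metric.mem_closure_iff.1 (mem_closure_ellTwoSumValues F lam) ε hε
  refine ⟨x, f, hx, hf, fun T hT => ?_⟩
  rw [← dist_eq_norm, dist_comm]
  exact (dist_le_pi_dist _ _ (⟨T, hT⟩ : F)).trans_lt hd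

end Approximation

section Representation

theorem isCountablyIncomplete_of_le_atTop {ι : Type*} [Preorder ι] [Nonempty ι]
    {U : Ultrafilter (ι × ℕ)} (hU : (U : Filter (ι × ℕ)) ≤ atTop) : IsCountablyIncomplete U := by
  refine ⟨fun n => {p | n ≤ p.2}, fun n => hU ?_, fun n p hp => ?_, ?_⟩
  · filter_upwards [mem_atTop ((Classical.arbitrary ι, n) : ι × ℕ)] with p hp
    exact hp.2
  · exact (Nat.le_succ n).trans hp
  · refine Set.eq_empty_of_forall_notMem fun p hp => ?_
    exact Nat.not_succ_le_self p.2 (Set.mem_iInter.1 hp (p.2 + 1))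

variable {𝕜 : Type*} [RCLike 𝕜] {X : Type*} [NormedAddCommGroup X] [NormedSpace 𝕜 X]

theorem exists_eq_ultraTensor {U : Ultrafilter (Finset (X →L[𝕜] X) × ℕ)}
    (hU : (U : Filter (Finset (X →L[𝕜] X) × ℕ)) ≤ atTop) (lam : StrongDual 𝕜 (X →L[𝕜] X)) :
    ∃ (xU : Ultrapower 𝕜 U (EllTwo X)) (fU : Ultrapower 𝕜 U (EllTwo (StrongDual 𝕜 X))),
      lam = ultraTensor U xU fU := by
  choose x f hx hf happrox using fun p : Finset (X →L[𝕜] X) × ℕ =>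
    exists_ellTwoSum_approx lam p.1 (Nat.one_div_pos_of_nat (α := ℝ) (n := p.2))
  let xI : EllInfty (Finset (X →L[𝕜] X) × ℕ) (EllTwo X) :=
    ⟨x, memℓp_infty ⟨1, by rintro _ ⟨p, rfl⟩; exact hx p⟩⟩
  let fI : EllInfty (Finset (X →L[𝕜] X) × ℕ) (EllTwo (StrongDual 𝕜 X)) :=
    ⟨f, memℓp_infty ⟨‖lam‖, by rintro _ ⟨p, rfl⟩; exact hf p⟩⟩
  refine ⟨Ultrapower.mk 𝕜 U xI, Ultrapower.mk 𝕜 U fI, ?_⟩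
  ext T
  refine tendsto_nhds_unique ?_ (tendsto_ultraTensor_mk U xI fI T)
  have hsnd : Tendsto (fun p : Finset (X →L[𝕜] X) × ℕ => p.2) U atTop := by
    refine Tendsto.mono_left ?_ hU
    rw [← prod_atTop_atTop_eq]
    exact tendsto_snd
  have hT : ∀ᶠ p in (U : Filter (Finset (X →L[𝕜] X) × ℕ)), T ∈ p.1 := by
    refine hU ?_
    filter_upwards [mem_atTop (({T}, 0) : Finset (X →L[𝕜] X) × ℕ)] with p hp
    exact Finset.singleton_subset_iff.1 hp.1
  rw [tendsto_iff_norm_sub_tendsto_zero]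
  refine squeeze_zero' (Eventually.of_forall fun p => norm_nonneg _)
    (hT.mono fun p hp => (happrox p T hp).le)
    ((tendsto_one_div_add_atTop_nhds_zero_nat (𝕜 := ℝ)).comp hsnd)

end Representation

theorem lemma4p1 {𝕜 : Type*} [RCLike 𝕜] {X : Type u} [NormedAddCommGroup X] [NormedSpace 𝕜 X]
    [CompleteSpace X] (hX : IsReflexiveSpace 𝕜 X) :
    ∃ (I : Type u) (U : Ultrafilter I), IsCountablyIncomplete U ∧
      ∀ lam : StrongDual 𝕜 (X →L[𝕜] X),
        ∃ (xU : Ultrapower 𝕜 U (EllTwo X)) (fU : Ultrapower 𝕜 U (EllTwo (StrongDual 𝕜 X))),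
          lam = ultraTensor U xU fU := by
  classical
  have hU : (Ultrafilter.of (atTop : Filter (Finset (X →L[𝕜] X) × ℕ)) :
      Filter (Finset (X →L[𝕜] X) × ℕ)) ≤ atTop := Ultrafilter.of_le _
  exact ⟨Finset (X →L[𝕜] X) × ℕ, Ultrafilter.of atTop, isCountablyIncomplete_of_le_atTop hU,
    exists_eq_ultraTensor hU⟩
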